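/- Let $n\ge 0$ and let $\sigma$ be a permutation of $\{1,\dots,n\}$. Let $\operatorname{depth}(\sigma)=\sum_{\sigma(i)>i}(\sigma(i)-i)$, let $\ell_S(\sigma)$ be the minimal number of adjacent transpositions whose product is $\sigma$, and let $\ell_T(\sigma)$ be the minimal number of transpositions whose product is $\sigma$. Let $\Phi$ be the fundamental bijection: write each cycle of $\sigma$ (including fixed points) as $(m\ \sigma(m)\ \sigma^2(m)\cdots)$ with $m$ its largest element, order the cycles from left to right by increasing largest element, and erase the parentheses; the resulting word is the one-line notation of $\Phi(\sigma)$. Write $\phi=\Phi(\sigma)=\phi_1\phi_2\cdots\phi_n$ in one-line notation. * (Underlined letters must be adjacent.) An occurrence in $\phi$ of the vincular pattern $\underline{31}\,\underline{42}$ is a subsequence $\phi_{i}\,\phi_{i+1}\,\phi_{j}\,\phi_{j+1}$ with $i+1<j$ whose letters are in the same relative order as $3142$, i.e. $\phi_{i+1}<\phi_{j+1}<\phi_i<\phi_j$. * An occurrence in $\phi$ of the arrow pattern $\underline{2}\,\underline{13}$ with arrow $2\to4$ is a subsequence $\phi_i\,\phi_j\,\phi_{j+1}$ with $i<j$ such that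 $\phi_j<\phi_i<\phi_{j+1}<\sigma(\phi_i)$. The count of a pattern in $\phi$ is its number of occurrences in $\phi$, and $\phi$ avoids a pattern if it has no occurrence of it. Then $$\operatorname{depth}(\sigma)=\frac{\ell_S(\sigma)+\ell_T(\sigma)}{2}+c_1+c_2,$$ where $c_1$ is the count of $\underline{31}\,\underline{42}$ in $\Phi(\sigma)$ and $c_2$ is the count of the arrow pattern $\underline{2}\,\underline{13}$ with arrow $2\to4$ in $\Phi(\sigma)$. In particular, $\sigma$ is shallow, meaning $\operatorname{depth}(\sigma)=(\ell_S(\sigma)+\ell_T(\sigma))/2$, if and only if $\Phi(\sigma)$ avoids both $\underline{31}\,\underline{42}$ and the arrow pattern $\underline{2}\,\underline{13}$ with arrow $2\to4$. -/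

import Mathlib

namespace ShallowPerm

/-! ### Length, reflection length, depth

Permutations of `{1, …, n}` are modelled as `Equiv.Perm (Fin n)` (letters shifted down by one). -/

/-- The simple reflections: adjacent transpositions `(i  i+1)`. -/
def simpleReflections (n : ℕ) : Set (Equiv.Perm (Fin n)) :=
  {s | ∃ i j : Fin n, (j : ℕ) = (i : ℕ) + 1 ∧ s = Equiv.swap i j}

/-- The reflections: conjugates of simple reflections. -/
def reflections (n : ℕ) : Set (Equiv.Perm (Fin n)) :=
  {t | ∃ g : Equiv.Perm (Fin n), ∃ s ∈ simpleReflections n, t = g * s * g⁻¹}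

/-- The numbers `k` such that `g` is a product of `k` elements of `A`. -/
def wordLengths {G : Type*} [Monoid G] (A : Set G) (g : G) : Set ℕ :=
  {k | ∃ l : List G, l.length = k ∧ (∀ a ∈ l, a ∈ A) ∧ l.prod = g}

/-- `ℓ_S(σ)`, the minimal number of simple reflections whose product is `σ`. -/
noncomputable def length {n : ℕ} (σ : Equiv.Perm (Fin n)) : ℕ :=
  sInf (wordLengths (simpleReflections n) σ)

/-- `ℓ_T(σ)`, the minimal number of reflections whose product is `σ`. -/
noncomputable def reflectionLength {n : ℕ} (σ : Equiv.Perm (Fin n)) : ℕ :=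
  sInf (wordLengths (reflections n) σ)

/-- The minimum defining `length` is over a nonempty set. -/
theorem wordLengths_simpleReflections_nonempty {n : ℕ} (σ : Equiv.Perm (Fin n)) :
    (wordLengths (simpleReflections n) σ).Nonempty := by
  have h : σ ∈ Submonoid.closure (simpleReflections n) := by
    rcases n with _ | n
    · rw [Subsingleton.elim σ 1]
      exact one_mem _
    · have htop := Equiv.Perm.mclosure_swap_castSucc_succ n
      have hle : Submonoid.closure
          (Set.range fun i : Fin n => Equiv.swap i.castSucc i.succ) ≤
            Submonoid.closure (simpleReflections (n + 1)) := by
        apply Submonoid.closure_mono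
        rintro _ ⟨i, rfl⟩
        exact ⟨i.castSucc, i.succ, by simp, rfl⟩
      rw [htop] at hle
      exact hle trivial
  obtain ⟨l, hl, hp⟩ := Submonoid.exists_list_of_mem_closure h
  exact ⟨l.length, l, rfl, hl, hp⟩

/-- The minimum defining `reflectionLength` is over a nonempty set. -/
theorem wordLengths_reflections_nonempty {n : ℕ} (σ : Equiv.Perm (Fin n)) :
    (wordLengths (reflections n) σ).Nonempty := by
  obtain ⟨k, l, hk, hl, hp⟩ := wordLengths_simpleReflections_nonempty σ
  exact ⟨k, l, hk, fun a ha => ⟨1, a, hl a ha, by simp⟩, hp⟩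

/-- `depth(σ) = ∑_{σ(i) > i} (σ(i) - i)`. -/
def depth {n : ℕ} (σ : Equiv.Perm (Fin n)) : ℕ :=
  ∑ i : Fin n with i < σ i, ((σ i : ℕ) - (i : ℕ))

/-- `σ` is shallow if `depth(σ) = (ℓ_S(σ) + ℓ_T(σ)) / 2`. -/
def IsShallow {n : ℕ} (σ : Equiv.Perm (Fin n)) : Prop :=
  (depth σ : ℚ) = ((length σ : ℚ) + (reflectionLength σ : ℚ)) / 2

/-! ### The fundamental bijection -/

/-- `m` is the largest element of its cycle (a fixed point forms a cycle on its own). -/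
def IsCycleMax {n : ℕ} (σ : Equiv.Perm (Fin n)) (m : Fin n) : Prop :=
  ∀ j : Fin n, σ.SameCycle m j → j ≤ m

/-- The cycle of `m` written with `m` first: `m, σ m, σ² m, …`. -/
noncomputable def cycleWord {n : ℕ} (σ : Equiv.Perm (Fin n)) (m : Fin n) : List (Fin n) :=
  (List.range (Function.minimalPeriod σ m)).map fun k => σ^[k] m

open Classical in
/-- The largest elements of the cycles of `σ`, in increasing order. -/
noncomputable def cycleMaxima {n : ℕ} (σ : Equiv.Perm (Fin n)) : List (Fin n) :=
  (List.finRange n).filter fun m => IsCycleMax σ m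

/-- The standard representation of `σ` with the cycle demarcations erased: every cycle starts
with its largest element, and the cycles are in increasing order of their largest elements. -/
noncomputable def standardWord {n : ℕ} (σ : Equiv.Perm (Fin n)) : List (Fin n) :=
  (cycleMaxima σ).flatMap (cycleWord σ)

theorem minimalPeriod_pos {n : ℕ} (σ : Equiv.Perm (Fin n)) (m : Fin n) :
    0 < Function.minimalPeriod σ m :=
  Function.minimalPeriod_pos_of_mem_periodicPts
    (Function.Injective.mem_periodicPts σ.injective m)

theorem mem_cycleWord {n : ℕ} (σ : Equiv.Perm (Fin n)) (m x : Fin n) :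
    x ∈ cycleWord σ m ↔ σ.SameCycle m x := by
  constructor
  · intro h
    obtain ⟨k, -, rfl⟩ := List.mem_map.1 h
    exact ⟨k, by simp [Equiv.Perm.iterate_eq_pow]⟩
  · intro h
    obtain ⟨k, hk⟩ := h.exists_nat_pow_eq
    refine List.mem_map.2 ⟨k % Function.minimalPeriod σ m,
      List.mem_range.2 (Nat.mod_lt _ (minimalPeriod_pos σ m)), ?_⟩
    rw [Function.iterate_mod_minimalPeriod_eq, Equiv.Perm.iterate_eq_pow, hk]

theorem mem_standardWord {n : ℕ} (σ : Equiv.Perm (Fin n)) (x : Fin n) :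
    x ∈ standardWord σ := by
  classical
  obtain ⟨m, hm, hmax⟩ := (Finset.univ.filter fun j => σ.SameCycle x j).exists_max_image id
    ⟨x, by simp [Equiv.Perm.SameCycle.refl]⟩
  have hm' : σ.SameCycle x m := by simpa using hm
  refine List.mem_flatMap.2 ⟨m, ?_, (mem_cycleWord σ m x).2 hm'.symm⟩
  simp only [cycleMaxima, List.mem_filter, List.mem_finRange, true_and, decide_eq_true_eq]
  exact fun j hj => hmax j (by simpa using hm'.trans hj)

theorem nodup_standardWord {n : ℕ} (σ : Equiv.Perm (Fin n)) : (standardWord σ).Nodup := by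
  classical
  refine List.nodup_flatMap.2 ⟨fun m _ => ?_, ?_⟩
  · refine List.Nodup.map_on (fun a ha b hb hab => ?_) List.nodup_range
    exact Function.iterate_injOn_Iio_minimalPeriod (List.mem_range.1 ha) (List.mem_range.1 hb) hab
  · have hnd : (cycleMaxima σ).Nodup := (List.nodup_finRange n).filter _
    refine hnd.pairwise_of_forall_ne fun a ha b hb hab => ?_
    intro x hxa hxb
    simp only [cycleMaxima, List.mem_filter, List.mem_finRange, true_and,
      decide_eq_true_eq] at ha hb
    have h := ((mem_cycleWord σ a x).1 hxa).trans ((mem_cycleWord σ b x).1 hxb).symm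
    exact hab (le_antisymm (hb a h.symm) (ha b h))

theorem length_standardWord {n : ℕ} (σ : Equiv.Perm (Fin n)) :
    (standardWord σ).length = n := by
  classical
  have h := Fintype.card_congr
    (List.Nodup.getEquivOfForallMemList _ (nodup_standardWord σ) (mem_standardWord σ))
  simpa using h

/-- The fundamental bijection: `Φ(σ)` is the permutation whose one-line notation is the standard
representation of `σ` with the cycle demarcations erased. -/
noncomputable def fundamental {n : ℕ} (σ : Equiv.Perm (Fin n)) : Equiv.Perm (Fin n) :=
  (finCongr (length_standardWord σ).symm).trans
    (List.Nodup.getEquivOfForallMemList _ (nodup_standardWord σ) (mem_standardWord σ))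

/-- The one-line notation of `fundamental σ` is `standardWord σ`. -/
theorem ofFn_fundamental {n : ℕ} (σ : Equiv.Perm (Fin n)) :
    List.ofFn (fundamental σ) = standardWord σ := by
  apply List.ext_get
  · simp [length_standardWord]
  · intro i h1 h2
    simp [fundamental]

/-! ### Vincular patterns and arrow patterns -/

/-- A vincular pattern with `m` letters taken from `{1, …, k}` (shifted to `Fin k`), all distinct.
For `k = m` the word is the one-line notation of a permutation; `m < k` is needed for the
vincular part of an arrow pattern. `i ∈ bonds` means that the letters in positions `i` and `i + 1`
(counted from `0`) are bonded. -/
structure VincularPattern (k m : ℕ) where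
  word : Fin m → Fin k
  injective_word : Function.Injective word
  bonds : Set ℕ

/-- The sequence of values `ω` is an occurrence of `ν` in `τ`: it is a subsequence of the one-line
notation of `τ` (at positions `p`) that is order isomorphic to the word of `ν`, with bonded letters
in consecutive positions. -/
def VincularPattern.IsOccurrence {k m n : ℕ} (ν : VincularPattern k m) (τ : Equiv.Perm (Fin n))
    (ω : Fin m → Fin n) : Prop :=
  ∃ p : Fin m → Fin n, StrictMono p ∧ (∀ i, ω i = τ (p i)) ∧
    (∀ i j, ω i ≤ ω j ↔ ν.word i ≤ ν.word j) ∧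
    (∀ i j : Fin m, (i : ℕ) ∈ ν.bonds → (j : ℕ) = (i : ℕ) + 1 → (p j : ℕ) = (p i : ℕ) + 1)

/-- The number of occurrences of `ν` in `τ`. -/
noncomputable def VincularPattern.count {k m n : ℕ} (ν : VincularPattern k m)
    (τ : Equiv.Perm (Fin n)) : ℕ :=
  {ω : Fin m → Fin n | ν.IsOccurrence τ ω}.ncard

/-- `τ` avoids `ν`. -/
def VincularPattern.Avoids {k m n : ℕ} (ν : VincularPattern k m) (τ : Equiv.Perm (Fin n)) : Prop :=
  ¬ ∃ ω : Fin m → Fin n, ν.IsOccurrence τ ω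

/-- An arrow pattern in `𝔖_k`: a vincular pattern together with a set of arrows `b → c`, encoded as
pairs `(b, c)`, such that every letter of `{1, …, k}` occurs in the pattern or in an arrow. -/
structure ArrowPattern (k m : ℕ) extends VincularPattern k m where
  arrows : Set (Fin k × Fin k)
  cover : ∀ a : Fin k, (∃ i, word i = a) ∨ ∃ e ∈ arrows, e.1 = a ∨ e.2 = a

/-- `ω = (x_{a_1}, …, x_{a_m})` is an occurrence of the arrow pattern in `τ = Φ(σ)`: for some
`x_1 < ⋯ < x_k`, it is an occurrence of the vincular pattern `a_1 ⋯ a_m` in `τ`, and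
`σ(x_b) = x_c` for every arrow `b → c`. -/
def ArrowPattern.IsOccurrence {k m n : ℕ} (α : ArrowPattern k m) (τ : Equiv.Perm (Fin n))
    (ω : Fin m → Fin n) : Prop :=
  ∃ σ : Equiv.Perm (Fin n), fundamental σ = τ ∧
    ∃ x : Fin k → Fin n, StrictMono x ∧ (∀ i, ω i = x (α.word i)) ∧
      α.toVincularPattern.IsOccurrence τ ω ∧
      ∀ e ∈ α.arrows, σ (x e.1) = x e.2

/-- The number of occurrences of the arrow pattern `α` in `τ`. -/
noncomputable def ArrowPattern.count {k m n : ℕ} (α : ArrowPattern k m)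
    (τ : Equiv.Perm (Fin n)) : ℕ :=
  {ω : Fin m → Fin n | α.IsOccurrence τ ω}.ncard

/-- `τ` avoids the arrow pattern `α`. -/
def ArrowPattern.Avoids {k m n : ℕ} (α : ArrowPattern k m) (τ : Equiv.Perm (Fin n)) : Prop :=
  ¬ ∃ ω : Fin m → Fin n, α.IsOccurrence τ ω

/-- The vincular pattern `3142` with `31` bonded and `42` bonded. -/
def pattern31_42 : VincularPattern 4 4 where
  word := ![2, 0, 3, 1]
  injective_word := by decide
  bonds := {0, 2}

/-- The arrow pattern with vincular part `213`, where `13` is bonded, and the arrow `2 → 4`. -/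
def pattern2_13_arrow24 : ArrowPattern 4 3 where
  word := ![1, 0, 2]
  injective_word := by decide
  bonds := {1}
  arrows := {(1, 3)}
  cover := by
    intro a
    fin_cases a
    · exact Or.inl ⟨1, rfl⟩
    · exact Or.inl ⟨0, rfl⟩
    · exact Or.inl ⟨2, rfl⟩
    · exact Or.inr ⟨(1, 3), rfl, Or.inr rfl⟩

end ShallowPerm

namespace ShallowPerm

/-! Read `Φ(σ)` from left to right. For each prefix, delete all later letters from the cycles of
`σ`; the open cycle then closes up, its last letter `c` being sent to the largest letter `M` so far,
which is the maximum of that cycle. For a one-letter prefix depth, inversions and reflection length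
all vanish, and it remains to see what the next letter `a` changes.

If `a > M`, then `a` is a fixed point above everything else, and nothing changes. If `a < M`, the
arrow `c → M` becomes `c → a → M` and the reflection length grows by one. An old letter `x ≠ c` with
image `y` changes `2 * depth - inv` by `[x < a] - [y < a]`, plus 2 when `y < a < x < c` or `c < x <
a < y`. The brackets sum to `-[c < a]`, since the images rearrange the letters; together with the
pairs inside `{c, a}` they leave exactly 1, which matches the reflection length. The two exceptional
configurations are the occurrences of the two patterns whose last bonded pair is `c a`.

The step is `depthSum_insert` and `depthSum_append`, the induction `ReadsOff.depthSum_eq`. The link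
to `σ` is `length_eq_invCount` (length counts inversions), `reflectionLength_eq_nonMaxCount`
(reflection length is `n` minus the number of cycles) and `readsOff_letter` (left-to-right maxima of
the word start the cycles). -/

/-! ### Effect of one new letter on depth and inversions. Depth is a count of pairs, so that it
makes sense on any subset of the letters. -/

/-- The number of pairs `x i ≤ x j < f i` with `i, j < m`: the depth of `x i ↦ f i`. -/
def depthSum {α : Type*} [LinearOrder α] (x f : ℕ → α) (m : ℕ) : ℤ :=
  ∑ i ∈ Finset.range m, ∑ j ∈ Finset.range m, if x i ≤ x j ∧ x j < f i then 1 else 0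

/-- The number of inversions of the map `x i ↦ f i`, where `i < m`. -/
def invSum {α : Type*} [LinearOrder α] (x f : ℕ → α) (m : ℕ) : ℤ :=
  ∑ i ∈ Finset.range m, ∑ j ∈ Finset.range m, if x i < x j ∧ f j < f i then 1 else 0

open Finset in
theorem pairSum_congr {α : Type*} (P : α → α → α → α → Prop) [∀ a b c d, Decidable (P a b c d)]
    {x f g : ℕ → α} {k : ℕ} (h : ∀ i < k, f i = g i) :
    ∑ i ∈ range k, ∑ j ∈ range k, (if P (x i) (x j) (f i) (f j) then (1 : ℤ) else 0) =
      ∑ i ∈ range k, ∑ j ∈ range k, (if P (x i) (x j) (g i) (g j) then (1 : ℤ) else 0) :=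
  sum_congr rfl fun i hi => sum_congr rfl fun j hj => by
    rw [h i (mem_range.1 hi), h j (mem_range.1 hj)]

open Finset in
/-- Inserting a letter `a` into a cycle, between `c` and its image `M`, the largest letter. -/
theorem depthSum_insert {α : Type*} [LinearOrder α] {x f g : ℕ → α} {k : ℕ} {M : α}
    (hfg : ∀ i < k, f i = g i) (hfk : f k = M) (hgk : g k = x (k + 1)) (hgk' : g (k + 1) = M)
    (hne : ∀ i < k, x i ≠ x k) (hne' : ∀ i < k, x i ≠ x (k + 1)) (hca : x k ≠ x (k + 1))
    (hcM : x k ≤ M) (haM : x (k + 1) < M) (hfM : ∀ i < k, f i < M)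
    (hfa : ∀ i < k, f i ≠ x (k + 1))
    (hbal : ∑ i ∈ range k, (if f i < x (k + 1) then (1 : ℤ) else 0) =
      ∑ i ∈ range k, (if x i < x (k + 1) then (1 : ℤ) else 0) +
        if x k < x (k + 1) then 1 else 0) :
    2 * (depthSum x g (k + 2) - depthSum x f (k + 1)) =
      invSum x g (k + 2) - invSum x f (k + 1) + 1 +
      2 * ∑ i ∈ range k, (if f i < x (k + 1) ∧ x (k + 1) < x i ∧ x i < x k then (1 : ℤ) else 0) +
      2 * ∑ i ∈ range k, (if x k < x i ∧ x i < x (k + 1) ∧ x (k + 1) < f i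
        then (1 : ℤ) else 0) := by
  have hD := pairSum_congr (fun a b c _ => a ≤ b ∧ b < c) (x := x) hfg
  have hI := pairSum_congr (fun a b c d => a < b ∧ d < c) (x := x) hfg
  simp only [depthSum, invSum, sum_range_succ, sum_add_distrib, hfk, hgk, hgk']
  rw [← hD, ← hI]
  clear hD hI
  have h1 : ∀ P : α → α → Prop, ∀ [∀ a b, Decidable (P a b)],
      ∑ i ∈ range k, (if P (x i) (g i) then (1 : ℤ) else 0) =
        ∑ i ∈ range k, (if P (x i) (f i) then (1 : ℤ) else 0) := fun P _ =>
    sum_congr rfl fun i hi => by rw [hfg i (mem_range.1 hi)]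
  rw [h1 fun a b => a ≤ x k ∧ x k < b, h1 fun a b => a ≤ x (k + 1) ∧ x (k + 1) < b,
    h1 fun a b => a < x k ∧ x (k + 1) < b, h1 fun a b => x k < a ∧ b < x (k + 1),
    h1 fun a b => a < x (k + 1) ∧ M < b, h1 fun a b => x (k + 1) < a ∧ b < M]
  clear h1 hfg hfk hgk hgk' g
  generalize x k = c at *
  generalize x (k + 1) = a at *
  -- The change in `2 * depth - inv` from pairs involving the old letter `x i`, less the two pattern
  -- terms. It need not vanish for a single `i`; only its sum is controlled, by `hbal`.
  have key : ∀ i ∈ range k,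
    2 * (if x i ≤ a ∧ a < f i then (1 : ℤ) else 0) + 2 * (if c ≤ x i ∧ x i < a then (1 : ℤ) else 0)
    + 2 * (if a ≤ x i ∧ x i < M then (1 : ℤ) else 0) - 2 * (if c ≤ x i ∧ x i < M then (1 : ℤ) else 0)
    - (if x i < c ∧ a < f i then (1 : ℤ) else 0) - (if c < x i ∧ f i < a then (1 : ℤ) else 0)
    - (if x i < a ∧ M < f i then (1 : ℤ) else 0) - (if a < x i ∧ f i < M then (1 : ℤ) else 0)
    + (if x i < c ∧ M < f i then (1 : ℤ) else 0) + (if c < x i ∧ f i < M then (1 : ℤ) else 0)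
    - 2 * (if f i < a ∧ a < x i ∧ x i < c then (1 : ℤ) else 0)
    - 2 * (if c < x i ∧ x i < a ∧ a < f i then (1 : ℤ) else 0)
    = (if x i < a then (1 : ℤ) else 0) - (if f i < a then 1 else 0) := by
      intro i hi
      have hi := mem_range.1 hi
      have := hne i hi; have := hne' i hi; have := hfM i hi; have := hfa i hi
      clear hbal hne hne' hfM hfa
      generalize x i = y at *
      generalize f i = z at *
      have hzM : ¬ M < z := by order
      have hlt : z < M := by order
      rcases lt_or_gt_of_ne ‹y ≠ a› with h1 | h1 <;> rcases lt_or_gt_of_ne ‹y ≠ c› with h2 | h2 <;>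
        rcases lt_or_gt_of_ne ‹z ≠ a› with h3 | h3 <;> rcases lt_or_gt_of_ne hca with h4 | h4 <;>
        by_cases h5 : y < M <;>
        first
        | (exfalso; order)
        | (simp only [hzM, hlt, h1, h2, h3, h5, h1.le, h2.le, h1.not_gt, h2.not_gt,
            h3.not_gt, h1.not_ge, h2.not_ge, and_true, and_false, if_true, if_false]
           norm_num)
  replace key := sum_congr rfl key
  simp only [sum_add_distrib, sum_sub_distrib, ← mul_sum] at key
  -- Only pairs inside `{c, a}` remain, and they depend on the order of `c` and `a`.
  rcases lt_or_gt_of_ne hca with h | h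
  · simp only [h, h.le, h.not_gt, h.not_ge, haM, haM.not_gt, h.trans haM, lt_irrefl, le_refl,
      and_true, and_false, if_true, if_false] at hbal ⊢
    linarith
  · simp only [h, h.le, h.not_gt, h.not_ge, haM, haM.not_gt, lt_irrefl, le_refl,
      true_and, and_true, and_false, if_true, if_false] at hbal ⊢
    linarith

open Finset in
/-- Adding a fixed point that is larger than all the other letters. -/
theorem depthSum_append {α : Type*} [LinearOrder α] {x f g : ℕ → α} {m : ℕ}
    (hfg : ∀ i < m, f i = g i) (hgm : g m = x m) (hx : ∀ i < m, x i < x m)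
    (hf : ∀ i < m, f i < x m) :
    depthSum x g (m + 1) = depthSum x f m ∧ invSum x g (m + 1) = invSum x f m := by
  have hD := pairSum_congr (fun a b c _ => a ≤ b ∧ b < c) (x := x) hfg
  have hI := pairSum_congr (fun a b c d => a < b ∧ d < c) (x := x) hfg
  simp only [depthSum, invSum, sum_range_succ, sum_add_distrib, hgm]
  rw [← hD, ← hI]
  have h0 : ∀ P : ℕ → Prop, ∀ [DecidablePred P], (∀ i < m, ¬ P i) →
      ∑ i ∈ range m, (if P i then (1 : ℤ) else 0) = 0 := fun P _ h =>
    sum_eq_zero fun i hi => if_neg (h i (mem_range.1 hi))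
  rw [h0 (fun i => x i ≤ x m ∧ x m < g i) fun i hi h => (hfg i hi ▸ hf i hi).not_gt h.2,
    h0 (fun i => x m ≤ x i ∧ x i < x m) fun i hi h => h.1.not_gt h.2,
    h0 (fun i => x i < x m ∧ x m < g i) fun i hi h => (hfg i hi ▸ hf i hi).not_gt h.2,
    h0 (fun i => x m < x i ∧ g i < x m) fun i hi h => h.1.not_gt (hx i hi)]
  simp

/-! ### Induction over the prefixes of a word. -/

/-- The largest of the letters `w 0, …, w k`. -/
def runMax {α : Type*} [LinearOrder α] (w : ℕ → α) : ℕ → α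
  | 0 => w 0
  | k + 1 => max (runMax w k) (w (k + 1))

theorem le_runMax {α : Type*} [LinearOrder α] (w : ℕ → α) {i k : ℕ} (h : i ≤ k) :
    w i ≤ runMax w k := by
  induction k with
  | zero => rw [Nat.le_zero.1 h]; rfl
  | succ k ih =>
    rcases Nat.le_succ_iff.1 h with h | rfl
    · exact (ih h).trans (le_max_left _ _)
    · exact le_max_right _ _

theorem exists_eq_runMax {α : Type*} [LinearOrder α] (w : ℕ → α) (k : ℕ) :
    ∃ i ≤ k, w i = runMax w k := by
  induction k with
  | zero => exact ⟨0, le_rfl, rfl⟩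
  | succ k ih =>
    obtain ⟨i, hi, h⟩ := ih
    rcases max_choice (runMax w k) (w (k + 1)) with h' | h'
    · exact ⟨i, by omega, by rw [h, runMax, h']⟩
    · exact ⟨k + 1, le_rfl, by rw [runMax, h']⟩

/-- The images of the letters `w 0, …, w k` when `w (k + 1), …` are deleted from their cycles. -/
def closedMap {α : Type*} [LinearOrder α] (w f : ℕ → α) (k : ℕ) : ℕ → α :=
  fun i => if i = k then runMax w k else f i

open Finset in
/-- The number of occurrences of `31-42` among the letters `w 0, …, w k`. -/
def crossSum {α : Type*} [LinearOrder α] (w : ℕ → α) (k : ℕ) : ℤ :=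
  ∑ q ∈ range k, ∑ p ∈ range q,
    if w (p + 1) < w (q + 1) ∧ w (q + 1) < w p ∧ w p < w q then 1 else 0

open Finset in
/-- The number of occurrences of `2-13` with arrow `2 → 4` among the letters `w 0, …, w k`,
where `f i` is the image of `w i`. -/
def arrowSum {α : Type*} [LinearOrder α] (w f : ℕ → α) (k : ℕ) : ℤ :=
  ∑ q ∈ range k, ∑ p ∈ range q,
    if w q < w p ∧ w p < w (q + 1) ∧ w (q + 1) < f p then 1 else 0

/-- The images of the letters are read off the word: the next letter, or the largest one so far
if the next letter starts a new cycle. -/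
def ReadsOff {α : Type*} [LinearOrder α] (w f : ℕ → α) (n : ℕ) : Prop :=
  ∀ k, k + 1 < n → f k = if w (k + 1) < runMax w k then w (k + 1) else runMax w k

-- The images `f 0, …, f (k - 1)`, together with the closing image `runMax w k`, rearrange `w 0, …,
-- w k`. Counting below every threshold `t` records this without naming a bijection.
open Finset in
theorem ReadsOff.sum_lt {α : Type*} [LinearOrder α] {w f : ℕ → α} {n : ℕ} (h : ReadsOff w f n)
    (t : α) {k : ℕ} (hk : k < n) :
    ∑ i ∈ range k, (if f i < t then (1 : ℤ) else 0) + (if runMax w k < t then 1 else 0) =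
      ∑ i ∈ range k, (if w i < t then (1 : ℤ) else 0) + if w k < t then 1 else 0 := by
  induction k with
  | zero => rfl
  | succ k ih =>
    have ih := ih (by omega)
    rw [sum_range_succ, sum_range_succ, h k hk, runMax]
    by_cases h1 : w (k + 1) < runMax w k
    · rw [if_pos h1, max_eq_left h1.le]
      linarith
    · rw [if_neg h1, max_eq_right (not_lt.1 h1)]
      linarith

theorem ReadsOff.lt_runMax {α : Type*} [LinearOrder α] {w f : ℕ → α} {n : ℕ}
    (h : ReadsOff w f n) (hw : Set.InjOn w (Set.Iio n)) {i k : ℕ} (hik : i < k) (hk : k < n) :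
    f i < runMax w k := by
  induction k with
  | zero => omega
  | succ k ih =>
    rcases Nat.lt_succ_iff_lt_or_eq.1 hik with hik | rfl
    · exact (ih hik (by omega)).trans_le (le_max_left _ _)
    · rw [h i hk, runMax]
      obtain ⟨j, hj, hj'⟩ := exists_eq_runMax w i
      have : w (i + 1) ≠ w j := fun e => by
        have := hw (x₁ := i + 1) (x₂ := j) hk (by simp; omega) e
        omega
      rw [hj'] at this
      split_ifs with h1
      · rwa [max_eq_left h1.le]
      · rw [max_eq_right (by order)]
        order

theorem ReadsOff.ne {α : Type*} [LinearOrder α] {w f : ℕ → α} {n : ℕ}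
    (h : ReadsOff w f n) (hw : Set.InjOn w (Set.Iio n)) {i k : ℕ} (hik : i + 1 < k) (hk : k < n) :
    f i ≠ w k := by
  rw [h i (by omega)]
  split_ifs with h1
  · intro e
    have := hw (x₁ := i + 1) (x₂ := k) (by simp; omega) hk e
    omega
  · obtain ⟨j, hj, hj'⟩ := exists_eq_runMax w i
    rw [← hj']
    intro e
    have := hw (x₁ := j) (x₂ := k) (by simp; omega) hk e
    omega

-- The theorem for each prefix: the middle sum counts the letters that do not start a cycle, which
-- is the reflection length of the closed-up prefix.
open Finset in
theorem ReadsOff.depthSum_eq {α : Type*} [LinearOrder α] {w f : ℕ → α} {n : ℕ}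
    (h : ReadsOff w f n) (hw : Set.InjOn w (Set.Iio n)) {k : ℕ} (hk : k < n) :
    2 * depthSum w (closedMap w f k) (k + 1) = invSum w (closedMap w f k) (k + 1) +
      ∑ i ∈ range k, (if w (i + 1) < runMax w i then 1 else 0) +
        2 * (crossSum w k + arrowSum w f k) := by
  induction k with
  | zero =>
    simp only [depthSum, invSum, crossSum, arrowSum, closedMap, runMax, zero_add, range_one,
      range_zero, sum_singleton, sum_empty, lt_irrefl, and_false, if_true, if_false]
  | succ k ih =>
    have ih := ih (by omega)
    have hne : ∀ i j, i < j → j < n → w i ≠ w j := fun i j hij hj e => by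
      have := hw (x₁ := i) (x₂ := j) (by simp; omega) hj e
      omega
    by_cases h1 : w (k + 1) < runMax w k
    · have hM : runMax w (k + 1) = runMax w k := max_eq_left h1.le
      have hfk : f k = w (k + 1) := by rw [h k hk, if_pos h1]
      have key := depthSum_insert (x := w) (f := closedMap w f k) (g := closedMap w f (k + 1))
        (k := k) (M := runMax w k)
        (fun i hi => by rw [closedMap, closedMap, if_neg (by omega), if_neg (by omega)])
        (by rw [closedMap, if_pos rfl]) (by rw [closedMap, if_neg (by omega), hfk])
        (by rw [closedMap, if_pos rfl, hM]) (fun i hi => hne _ _ hi (by omega))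
        (fun i hi => hne _ _ (by omega) hk) (hne _ _ (by omega) hk) (le_runMax w le_rfl) h1
        (fun i hi => by
          rw [closedMap, if_neg (by omega)]; exact h.lt_runMax hw hi (by omega))
        (fun i hi => by
          rw [closedMap, if_neg (by omega)]; exact h.ne hw (by omega) hk)
        -- The closing image exceeds `w (k + 1)`, so it drops out of the count below that letter.
        (by
          have := h.sum_lt (w (k + 1)) (k := k) (by omega)
          rw [if_neg h1.not_gt, add_zero] at this
          rw [← this]
          refine sum_congr rfl fun i hi => ?_
          rw [closedMap, if_neg (mem_range.1 hi).ne])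
      -- `crossSum` sees `w (i + 1)` where the insertion formula sees `f i`. They differ only if `w
      -- (i + 1)` starts a new cycle, and then both conditions fail because `w (i + 1)` and `f i`
      -- are at least `w i`.
      have hc : crossSum w (k + 1) = crossSum w k + ∑ i ∈ range k,
          (if closedMap w f k i < w (k + 1) ∧ w (k + 1) < w i ∧ w i < w k
            then (1 : ℤ) else 0) := by
        rw [crossSum, sum_range_succ, crossSum]
        congr 1
        refine sum_congr rfl fun i hi => ?_
        have hi := mem_range.1 hi
        rw [closedMap, if_neg hi.ne, h i (by omega)]
        have := le_runMax w (le_refl i)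
        split_ifs <;> first | rfl | (exfalso; grind)
      have ha : arrowSum w f (k + 1) = arrowSum w f k + ∑ i ∈ range k,
          (if w k < w i ∧ w i < w (k + 1) ∧ w (k + 1) < closedMap w f k i
            then (1 : ℤ) else 0) := by
        rw [arrowSum, sum_range_succ, arrowSum]
        congr 1
        refine sum_congr rfl fun i hi => ?_
        rw [closedMap, if_neg (mem_range.1 hi).ne]
      rw [hc, ha, sum_range_succ, if_pos h1]
      linarith
    · have hwk : ∀ i ≤ k, w i < w (k + 1) := fun i hi =>
        ((le_runMax w hi).trans (not_lt.1 h1)).lt_of_ne (hne _ _ (by omega) hk)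
      have hMk : runMax w k < w (k + 1) := by
        obtain ⟨j, hj, hj'⟩ := exists_eq_runMax w k
        rw [← hj']
        exact hwk j hj
      have hM : runMax w (k + 1) = w (k + 1) := max_eq_right hMk.le
      have hfk : f k = runMax w k := by rw [h k hk, if_neg h1]
      have hf : ∀ i < k + 1, closedMap w f k i = closedMap w f (k + 1) i := fun i hi => by
        rw [closedMap, closedMap, if_neg (show i ≠ k + 1 by omega)]
        split_ifs with e
        · rw [e, hfk]
        · rfl
      obtain ⟨hD, hI⟩ := depthSum_append (x := w) (m := k + 1) hf
        (by rw [closedMap, if_pos rfl, hM]) (fun i hi => hwk i (by omega))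
        (fun i hi => by
          rw [hf i hi, closedMap, if_neg (by omega), ← hM]
          exact h.lt_runMax hw hi hk)
      -- A new maximum cannot play the `2` of `31-42`, nor the `3` of `2-13`, which must lie below
      -- an earlier image.
      have hc : crossSum w (k + 1) = crossSum w k := by
        rw [crossSum, sum_range_succ, crossSum, add_eq_left]
        refine sum_eq_zero fun i hi => if_neg fun e => ?_
        exact e.2.1.not_gt (hwk i (mem_range.1 hi).le)
      have ha : arrowSum w f (k + 1) = arrowSum w f k := by
        rw [arrowSum, sum_range_succ, arrowSum, add_eq_left]
        refine sum_eq_zero fun i hi => if_neg fun e => ?_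
        have := h.lt_runMax hw (i := i) (k := k + 1) (by have := mem_range.1 hi; omega) hk
        rw [hM] at this
        exact e.2.2.not_gt this
      rw [hD, hI, hc, ha, sum_range_succ, if_neg h1]
      linarith


/-! ### Length and inversions -/

/-- The number of inversions of `σ`. -/
def invCount {n : ℕ} (σ : Equiv.Perm (Fin n)) : ℕ :=
  (Finset.univ.filter fun p : Fin n × Fin n => p.1 < p.2 ∧ σ p.2 < σ p.1).card

theorem swap_lt_swap_iff {n : ℕ} {i j a b : Fin n} (hij : (j : ℕ) = i + 1)
    (h : ¬ (a = i ∧ b = j)) (h' : ¬ (a = j ∧ b = i)) :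
    Equiv.swap i j a < Equiv.swap i j b ↔ a < b := by
  simp only [Equiv.swap_apply_def]
  split_ifs <;> simp only [Fin.lt_def, Fin.ext_iff] at * <;> omega

/-- An adjacent swap preserves the order of every pair of positions except `{i, j}`. Applied to both
entries, it carries the inversions of `σ` to those of the product other than `(i, j)`. -/
theorem invCount_mul_swap_of_lt {n : ℕ} (σ : Equiv.Perm (Fin n)) {i j : Fin n}
    (hij : (j : ℕ) = i + 1) (h : σ i < σ j) :
    invCount (σ * Equiv.swap i j) = invCount σ + 1 := by
  have hlt : i < j := by simp only [Fin.lt_def]; omega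
  set e : Fin n × Fin n ≃ Fin n × Fin n := (Equiv.swap i j).prodCongr (Equiv.swap i j) with he
  have hnot : (i, j) ∉ (Finset.univ.filter fun p : Fin n × Fin n =>
      p.1 < p.2 ∧ σ p.2 < σ p.1).map e.toEmbedding := by
    simp only [Finset.mem_map_equiv, he, Finset.mem_filter, Finset.mem_univ, true_and]
    simp [hlt.not_gt]
  have hcard := Finset.card_insert_of_notMem hnot
  rw [Finset.card_map] at hcard
  rw [invCount, invCount, ← hcard]
  congr 1
  ext ⟨a, b⟩
  rw [Finset.mem_insert, Finset.mem_map_equiv, Finset.mem_filter, Finset.mem_filter]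
  simp only [he, Finset.mem_univ, true_and, Prod.mk.injEq, Equiv.Perm.mul_apply, Equiv.prodCongr_symm, Equiv.symm_swap, Equiv.prodCongr_apply, Prod.map]
  by_cases h1 : a = i ∧ b = j
  · obtain ⟨rfl, rfl⟩ := h1
    simp [hlt, h]
  by_cases h2 : a = j ∧ b = i
  · obtain ⟨rfl, rfl⟩ := h2
    simp [hlt.not_gt, h.not_gt, hlt.ne']
  rw [swap_lt_swap_iff hij h1 h2]
  simp [h1]

theorem invCount_mul_swap_of_gt {n : ℕ} (σ : Equiv.Perm (Fin n)) {i j : Fin n}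
    (hij : (j : ℕ) = i + 1) (h : σ j < σ i) :
    invCount σ = invCount (σ * Equiv.swap i j) + 1 := by
  have := invCount_mul_swap_of_lt (σ * Equiv.swap i j) hij (by simpa using h)
  rwa [mul_assoc, Equiv.swap_mul_self, mul_one] at this

theorem invCount_one (n : ℕ) : invCount (1 : Equiv.Perm (Fin n)) = 0 := by
  rw [invCount, Finset.card_eq_zero, Finset.filter_eq_empty_iff]
  exact fun p _ h => h.1.not_gt h.2

theorem eq_one_of_adjacent_lt {n : ℕ} (σ : Equiv.Perm (Fin n))
    (h : ∀ i j : Fin n, (j : ℕ) = i + 1 → σ i < σ j) : σ = 1 := by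
  rcases n with _ | n
  · exact Subsingleton.elim _ _
  · have hm : StrictMono σ := Fin.strictMono_iff_lt_succ.2 fun i => h _ _ (by simp)
    have : (σ : Fin (n + 1) → Fin (n + 1)) = id :=
      (StrictMono.range_inj hm strictMono_id).1 (by simp [σ.surjective.range_eq])
    exact Equiv.ext fun x => congrFun this x

theorem invCount_le_length_of_prod {n : ℕ} (l : List (Equiv.Perm (Fin n)))
    (hl : ∀ a ∈ l, a ∈ simpleReflections n) : invCount l.prod ≤ l.length := by
  induction l using List.reverseRecOn with
  | nil => simp [invCount_one]
  | append_singleton l s ih =>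
    have ih := ih fun a ha => hl a (by simp [ha])
    obtain ⟨i, j, hij, rfl⟩ := hl s (by simp)
    rw [List.prod_append, List.prod_singleton, List.length_append, List.length_singleton]
    have hne : l.prod i ≠ l.prod j := l.prod.injective.ne fun e => by rw [e] at hij; omega
    rcases lt_or_gt_of_ne hne with h | h
    · rw [invCount_mul_swap_of_lt _ hij h]
      omega
    · have := invCount_mul_swap_of_gt _ hij h
      omega

/-- Bubble sort: undoing a descent at adjacent positions removes one inversion, and only the
identity has no such descent. -/
theorem invCount_mem_wordLengths {n : ℕ} (σ : Equiv.Perm (Fin n)) :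
    invCount σ ∈ wordLengths (simpleReflections n) σ := by
  induction hk : invCount σ generalizing σ with
  | zero =>
    refine ⟨[], rfl, by simp, ?_⟩
    rw [eq_one_of_adjacent_lt σ, List.prod_nil]
    intro i j hij
    by_contra hlt
    have hne : σ i ≠ σ j := σ.injective.ne fun e => by rw [e] at hij; omega
    have := invCount_mul_swap_of_gt σ hij (lt_of_le_of_ne (not_lt.1 hlt) hne.symm)
    omega
  | succ k ih =>
    have hne : ¬ ∀ i j : Fin n, (j : ℕ) = i + 1 → σ i < σ j := fun h => by
      rw [eq_one_of_adjacent_lt σ h, invCount_one] at hk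
      omega
    push Not at hne
    obtain ⟨i, j, hij, h⟩ := hne
    have hne : σ i ≠ σ j := σ.injective.ne fun e => by rw [e] at hij; omega
    have := invCount_mul_swap_of_gt σ hij (lt_of_le_of_ne h hne.symm)
    obtain ⟨l, hl, hs, hp⟩ := ih (σ * Equiv.swap i j) (by omega)
    refine ⟨l ++ [Equiv.swap i j], by simp [hl], fun a ha => ?_, ?_⟩
    · rcases List.mem_append.1 ha with ha | ha
      · exact hs a ha
      · exact ⟨i, j, hij, List.mem_singleton.1 ha⟩
    · rw [List.prod_append, hp, List.prod_singleton, mul_assoc, Equiv.swap_mul_self, mul_one]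

theorem length_eq_invCount {n : ℕ} (σ : Equiv.Perm (Fin n)) : length σ = invCount σ := by
  refine le_antisymm (Nat.sInf_le (invCount_mem_wordLengths σ)) ?_
  obtain ⟨l, hl, hs, hp⟩ := Nat.sInf_mem (wordLengths_simpleReflections_nonempty σ)
  rw [length, ← hl, ← hp]
  exact invCount_le_length_of_prod l hs

/-! ### Reflection length and cycles -/

theorem mem_reflections_iff {n : ℕ} {t : Equiv.Perm (Fin n)} :
    t ∈ reflections n ↔ ∃ a b : Fin n, a ≠ b ∧ t = Equiv.swap a b := by
  constructor
  · rintro ⟨g, _, ⟨i, j, hij, rfl⟩, rfl⟩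
    exact ⟨g i, g j, g.injective.ne fun e => by rw [e] at hij; omega,
      (Equiv.swap_apply_apply g i j).symm⟩
  · rintro ⟨a, b, hab, rfl⟩
    have hn : 1 < n := by
      have := a.isLt; have := b.isLt; have : (a : ℕ) ≠ b := fun e => hab (Fin.ext e)
      omega
    obtain ⟨g, hg⟩ := isConj_iff.1 (Equiv.Perm.isConj_swap
      (w := (⟨0, by omega⟩ : Fin n)) (x := ⟨1, hn⟩) (by simp) hab)
    exact ⟨g, _, ⟨_, _, rfl, rfl⟩, hg.symm⟩

theorem exists_isCycleMax {n : ℕ} (σ : Equiv.Perm (Fin n)) (x : Fin n) :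
    ∃ m, IsCycleMax σ m ∧ σ.SameCycle m x := by
  obtain ⟨m, hm, hx⟩ := List.mem_flatMap.1 (mem_standardWord σ x)
  simp only [cycleMaxima, List.mem_filter, List.mem_finRange, true_and, decide_eq_true_eq] at hm
  exact ⟨m, hm, (mem_cycleWord σ m x).1 hx⟩

theorem apply_eq_of_sameCycle {α β : Type*} {σ : Equiv.Perm α} {g : α → β}
    (h : ∀ x, g (σ x) = g x) {x y : α} (hxy : σ.SameCycle x y) : g x = g y := by
  obtain ⟨k, rfl⟩ := hxy
  induction k using Int.induction_on with
  | zero => rfl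
  | succ k ih => rw [add_comm, zpow_add, zpow_one, Equiv.Perm.mul_apply, h, ← ih]
  | pred k ih =>
    rw [ih, ← h ((σ ^ (-(k : ℤ) - 1)) x), ← Equiv.Perm.mul_apply, ← zpow_one_add]
    congr 3
    ring

/-- A labelling constant on the cycles of the product: start with distinct labels and, for each
factor `swap a b`, merge the labels of `a` and `b`, losing at most one. -/
theorem exists_label_of_prod {n : ℕ} (l : List (Equiv.Perm (Fin n)))
    (hl : ∀ a ∈ l, a ∈ reflections n) :
    ∃ g : Fin n → Fin n, (∀ x, g (l.prod x) = g x) ∧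
      n ≤ (Finset.univ.image g).card + l.length := by
  induction l with
  | nil => exact ⟨id, by simp, by simp⟩
  | cons s l ih =>
    obtain ⟨g, hg, hn⟩ := ih fun a ha => hl a (by simp [ha])
    obtain ⟨a, b, -, rfl⟩ := mem_reflections_iff.1 (hl s (by simp))
    refine ⟨fun x => if g x = g a then g b else g x, fun x => ?_, ?_⟩
    · have key : ∀ y, (if g (Equiv.swap a b y) = g a then g b else g (Equiv.swap a b y)) =
          if g y = g a then g b else g y := fun y => by
        rw [Equiv.swap_apply_def]
        split_ifs <;> simp_all
      have := key (l.prod x)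
      rw [hg x] at this
      rwa [List.prod_cons, Equiv.Perm.mul_apply]
    · have : Finset.univ.image g ⊆
          insert (g a) (Finset.univ.image fun x => if g x = g a then g b else g x) := by
        intro y hy
        obtain ⟨x, -, rfl⟩ := Finset.mem_image.1 hy
        by_cases h : g x = g a
        · simp [h]
        · exact Finset.mem_insert_of_mem (Finset.mem_image.2 ⟨x, Finset.mem_univ _, if_neg h⟩)
      have := (Finset.card_le_card this).trans (Finset.card_insert_le _ _)
      rw [List.length_cons]
      omega

open Classical in
/-- The number of letters that are not the largest element of their cycle. -/
noncomputable def nonMaxCount {n : ℕ} (σ : Equiv.Perm (Fin n)) : ℕ :=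
  (Finset.univ.filter fun x => ¬ IsCycleMax σ x).card

/-- Every label is carried by some cycle maximum, so there are at least as many cycles as labels. -/
theorem nonMaxCount_le_length_of_prod {n : ℕ} (l : List (Equiv.Perm (Fin n)))
    (hl : ∀ a ∈ l, a ∈ reflections n) : nonMaxCount l.prod ≤ l.length := by
  classical
  obtain ⟨g, hg, hn⟩ := exists_label_of_prod l hl
  have h1 : Finset.univ.image g ⊆
      (Finset.univ.filter fun x => IsCycleMax l.prod x).image g := by
    intro y hy
    obtain ⟨x, -, rfl⟩ := Finset.mem_image.1 hy
    obtain ⟨m, hm, hx⟩ := exists_isCycleMax l.prod x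
    exact Finset.mem_image.2 ⟨m, by simpa using hm, apply_eq_of_sameCycle hg hx⟩
  have h2 := (Finset.card_le_card h1).trans Finset.card_image_le
  have h3 := Finset.card_filter_add_card_filter_not (s := Finset.univ)
    (fun x => IsCycleMax l.prod x)
  rw [Finset.card_univ, Fintype.card_fin] at h3
  rw [nonMaxCount]
  omega

theorem eq_one_of_forall_isCycleMax {n : ℕ} {σ : Equiv.Perm (Fin n)}
    (h : ∀ x, IsCycleMax σ x) : σ = 1 :=
  Equiv.ext fun x => le_antisymm (h x _ ⟨1, by simp⟩) (h (σ x) _ ⟨-1, by simp⟩)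

/-- The swap splits `x` off as a fixed point. The new cycles lie inside the old ones, so old maxima
stay maxima and `x` becomes one. -/
theorem nonMaxCount_swap_mul_lt {n : ℕ} {σ : Equiv.Perm (Fin n)} {x : Fin n}
    (hx : ¬ IsCycleMax σ x) : nonMaxCount (Equiv.swap x (σ x) * σ) < nonMaxCount σ := by
  have hfix : (Equiv.swap x (σ x) * σ) x = x := by simp
  have hstep : ∀ y, σ.SameCycle ((Equiv.swap x (σ x) * σ) y) y := fun y => by
    rw [Equiv.Perm.mul_apply, Equiv.swap_apply_def]
    split_ifs with h1 h2
    · rw [← h1, Equiv.Perm.sameCycle_apply_left, Equiv.Perm.sameCycle_apply_left]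
    · rw [σ.injective h2]
    · rw [Equiv.Perm.sameCycle_apply_left]
  have hsame : ∀ y z, (Equiv.swap x (σ x) * σ).SameCycle y z → σ.SameCycle y z := fun y z h => by
    have := apply_eq_of_sameCycle (g := fun u => σ.SameCycle y u)
      (fun u => propext ⟨fun hu => hu.trans (hstep u), fun hu => hu.trans (hstep u).symm⟩) h
    exact this.mp (Equiv.Perm.SameCycle.refl _ _)
  classical
  rw [nonMaxCount, nonMaxCount]
  refine Finset.card_lt_card ((Finset.ssubset_iff_of_subset fun y hy => ?_).2 ⟨x, ?_, ?_⟩)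
  · simp only [Finset.mem_filter, Finset.mem_univ, true_and] at hy ⊢
    exact fun h => hy fun j hj => h j (hsame _ _ hj)
  · simpa using hx
  · simp only [Finset.mem_filter, Finset.mem_univ, true_and, not_not]
    intro j hj
    exact (Equiv.Perm.SameCycle.eq_of_left hj hfix).ge

theorem exists_prod_eq_length_le {n : ℕ} (σ : Equiv.Perm (Fin n)) :
    ∃ l : List (Equiv.Perm (Fin n)), (∀ a ∈ l, a ∈ reflections n) ∧ l.prod = σ ∧
      l.length ≤ nonMaxCount σ := by
  induction hk : nonMaxCount σ using Nat.strong_induction_on generalizing σ with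
  | _ k ih =>
    by_cases h : ∀ x, IsCycleMax σ x
    · exact ⟨[], by simp, by simp [eq_one_of_forall_isCycleMax h], by simp⟩
    · push Not at h
      obtain ⟨x, hx⟩ := h
      have hlt := nonMaxCount_swap_mul_lt hx
      obtain ⟨l, hl, hp, hle⟩ := ih _ (hk ▸ hlt) _ rfl
      have hne : x ≠ σ x := fun e => hx fun j hj =>
        (Equiv.Perm.SameCycle.eq_of_left hj e.symm).ge
      refine ⟨Equiv.swap x (σ x) :: l, fun a ha => ?_, ?_, ?_⟩
      · rcases List.mem_cons.1 ha with rfl | ha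
        · exact mem_reflections_iff.2 ⟨_, _, hne, rfl⟩
        · exact hl a ha
      · rw [List.prod_cons, hp, ← mul_assoc, Equiv.swap_mul_self, one_mul]
      · rw [List.length_cons]
        omega

theorem reflectionLength_eq_nonMaxCount {n : ℕ} (σ : Equiv.Perm (Fin n)) :
    reflectionLength σ = nonMaxCount σ := by
  apply le_antisymm
  · obtain ⟨l, hl, hp, hle⟩ := exists_prod_eq_length_le σ
    exact (Nat.sInf_le ⟨l, rfl, hl, hp⟩ : reflectionLength σ ≤ l.length).trans hle
  · obtain ⟨l, hl, hs, hp⟩ := Nat.sInf_mem (wordLengths_reflections_nonempty σ)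
    rw [reflectionLength, ← hl, ← hp]
    exact nonMaxCount_le_length_of_prod l hs


/-! ### The word of the fundamental bijection -/

/-- The letters of `fundamental σ`, indexed by natural numbers. -/
noncomputable def letter {n : ℕ} [NeZero n] (σ : Equiv.Perm (Fin n)) (p : ℕ) : Fin n :=
  fundamental σ (Fin.ofNat n p)

theorem letter_val {n : ℕ} [NeZero n] (σ : Equiv.Perm (Fin n)) (p : Fin n) :
    letter σ p = fundamental σ p := by
  rw [letter, Fin.ofNat_val_eq_self]

theorem getElem_standardWord {n : ℕ} [NeZero n] (σ : Equiv.Perm (Fin n)) (p : ℕ)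
    (hp : p < (standardWord σ).length) : (standardWord σ)[p] = letter σ p := by
  have hpn : p < n := by rwa [length_standardWord] at hp
  have := letter_val σ ⟨p, hpn⟩
  rw [this]
  simp only [← ofFn_fundamental, List.getElem_ofFn]

/-- Indices are reduced modulo `n`, hence the restriction to indices below `n`. -/
theorem letter_injOn {n : ℕ} [NeZero n] (σ : Equiv.Perm (Fin n)) :
    Set.InjOn (letter σ) (Set.Iio n) := by
  intro p hp q hq h
  have h := (letter_val σ ⟨p, hp⟩).symm.trans (h.trans (letter_val σ ⟨q, hq⟩))
  exact congrArg Fin.val ((fundamental σ).injective h)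

theorem exists_letter_eq {n : ℕ} [NeZero n] (σ : Equiv.Perm (Fin n)) (x : Fin n) :
    ∃ p < n, letter σ p = x :=
  ⟨(fundamental σ).symm x, Fin.isLt _, by rw [letter_val, Equiv.apply_symm_apply]⟩

theorem IsCycleMax.eq_of_sameCycle {n : ℕ} {σ : Equiv.Perm (Fin n)} {x y : Fin n}
    (hx : IsCycleMax σ x) (hy : IsCycleMax σ y) (h : σ.SameCycle x y) : x = y :=
  le_antisymm (hy x h.symm) (hx y h)

/-- The relation between consecutive letters of the standard word. -/
def IsNextLetter {n : ℕ} (σ : Equiv.Perm (Fin n)) (x y : Fin n) : Prop :=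
  (¬ IsCycleMax σ y ∧ σ x = y) ∨ (IsCycleMax σ y ∧ IsCycleMax σ (σ x) ∧ σ x < y)

theorem isChain_cycleWord {n : ℕ} {σ : Equiv.Perm (Fin n)} {m : Fin n} (hm : IsCycleMax σ m) :
    (cycleWord σ m).IsChain (IsNextLetter σ) := by
  rw [List.isChain_iff_getElem]
  intro i hi
  simp only [cycleWord, List.length_map, List.length_range] at hi
  simp only [cycleWord, List.getElem_map, List.getElem_range]
  refine Or.inl ⟨fun h => ?_, (Function.iterate_succ_apply' _ _ _).symm⟩
  have hs : σ.SameCycle m (σ^[i + 1] m) := ⟨(i + 1 : ℕ), by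
    rw [zpow_natCast, Equiv.Perm.iterate_eq_pow]⟩
  exact Function.not_isPeriodicPt_of_pos_of_lt_minimalPeriod (Nat.succ_ne_zero i) hi
    (hm.eq_of_sameCycle h hs).symm

theorem cycleWord_eq_cons {n : ℕ} (σ : Equiv.Perm (Fin n)) (m : Fin n) :
    ∃ l, cycleWord σ m = m :: l := by
  obtain ⟨k, hk⟩ := Nat.exists_eq_succ_of_ne_zero (minimalPeriod_pos σ m).ne'
  rw [cycleWord, hk, List.range_succ_eq_map]
  exact ⟨_, rfl⟩

theorem apply_getLast_cycleWord {n : ℕ} {σ : Equiv.Perm (Fin n)} {m x : Fin n}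
    (hx : x ∈ (cycleWord σ m).getLast?) : σ x = m := by
  obtain ⟨k, hk⟩ := Nat.exists_eq_succ_of_ne_zero (minimalPeriod_pos σ m).ne'
  rw [cycleWord, hk, List.range_succ, List.map_append, List.map_singleton,
    List.getLast?_append_of_ne_nil _ (List.cons_ne_nil _ _), List.getLast?_singleton,
    Option.mem_some_iff] at hx
  rw [← hx, ← Function.iterate_succ_apply' σ, ← hk]
  exact Function.iterate_minimalPeriod

theorem isCycleMax_of_mem_cycleMaxima {n : ℕ} {σ : Equiv.Perm (Fin n)} {m : Fin n}
    (hm : m ∈ cycleMaxima σ) : IsCycleMax σ m := by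
  simpa [cycleMaxima] using hm

theorem isChain_standardWord {n : ℕ} (σ : Equiv.Perm (Fin n)) :
    (standardWord σ).IsChain (IsNextLetter σ) := by
  rw [standardWord, List.flatMap_def, List.isChain_flatten]
  · refine ⟨fun l hl => ?_, ?_⟩
    · obtain ⟨m, hm, rfl⟩ := List.mem_map.1 hl
      exact isChain_cycleWord (isCycleMax_of_mem_cycleMaxima hm)
    · rw [List.isChain_map]
      have hp : (cycleMaxima σ).Pairwise (· < ·) := (List.pairwise_lt_finRange n).filter _
      refine List.Pairwise.isChain (hp.imp_of_mem fun {a b} ha hb hab x hx y hy => ?_)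
      obtain ⟨l, hl⟩ := cycleWord_eq_cons σ b
      rw [hl, List.head?_cons, Option.mem_some_iff] at hy
      subst hy
      -- At a junction, the last letter of one cycle maps back to its maximum `a`, which is below
      -- the next maximum `b`.
      have hx := apply_getLast_cycleWord hx
      rw [IsNextLetter, hx]
      exact Or.inr ⟨isCycleMax_of_mem_cycleMaxima hb, isCycleMax_of_mem_cycleMaxima ha, hab⟩
  · intro h
    obtain ⟨m, -, hm⟩ := List.mem_map.1 h
    obtain ⟨l, hl⟩ := cycleWord_eq_cons σ m
    exact List.cons_ne_nil _ _ (hl.symm.trans hm)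

theorem isNextLetter_letter {n : ℕ} [NeZero n] (σ : Equiv.Perm (Fin n)) {k : ℕ}
    (hk : k + 1 < n) : IsNextLetter σ (letter σ k) (letter σ (k + 1)) := by
  have h : k + 1 < (standardWord σ).length := by rwa [length_standardWord]
  have := (isChain_standardWord σ).getElem k h
  rwa [getElem_standardWord, getElem_standardWord] at this

theorem isCycleMax_letter_zero {n : ℕ} [NeZero n] (σ : Equiv.Perm (Fin n)) :
    IsCycleMax σ (letter σ 0) := by
  have h0 : 0 < (standardWord σ).length := by
    rw [length_standardWord]; exact Nat.pos_of_ne_zero (NeZero.ne n)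
  rw [← getElem_standardWord σ 0 h0]
  rcases hc : cycleMaxima σ with _ | ⟨m, l⟩
  · simp [standardWord, hc] at h0
  · obtain ⟨l', hl'⟩ := cycleWord_eq_cons σ m
    have : (standardWord σ)[0] = m := by
      simp [standardWord, hc, hl']
    rw [this]
    exact isCycleMax_of_mem_cycleMaxima (by simp [hc])

/-- Recovers the cycles from the erased word: the running maximum is always the maximum of the cycle
being read. -/
theorem isCycleMax_runMax {n : ℕ} [NeZero n] (σ : Equiv.Perm (Fin n)) {k : ℕ} (hk : k < n) :
    IsCycleMax σ (runMax (letter σ) k) ∧ σ.SameCycle (runMax (letter σ) k) (letter σ k) := by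
  induction k with
  | zero => exact ⟨isCycleMax_letter_zero σ, Equiv.Perm.SameCycle.refl _ _⟩
  | succ k ih =>
    obtain ⟨hM, hs⟩ := ih (by omega)
    have hs' := hs.trans (y := letter σ k) (z := σ (letter σ k)) ⟨1, by simp⟩
    rcases isNextLetter_letter σ hk with ⟨-, he⟩ | ⟨h1, h2, h3⟩
    · rw [he] at hs'
      rw [runMax, max_eq_left (hM _ hs')]
      exact ⟨hM, hs'⟩
    · rw [← hM.eq_of_sameCycle h2 hs'] at h3
      rw [runMax, max_eq_right h3.le]
      exact ⟨h1, Equiv.Perm.SameCycle.refl _ _⟩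

theorem letter_lt_runMax_iff {n : ℕ} [NeZero n] (σ : Equiv.Perm (Fin n)) {k : ℕ}
    (hk : k + 1 < n) : letter σ (k + 1) < runMax (letter σ) k ↔ ¬ IsCycleMax σ (letter σ (k + 1)) := by
  obtain ⟨hM, hs⟩ := isCycleMax_runMax σ (k := k) (by omega)
  have hs' := hs.trans (y := letter σ k) (z := σ (letter σ k)) ⟨1, by simp⟩
  rcases isNextLetter_letter σ hk with ⟨h1, he⟩ | ⟨h1, h2, h3⟩
  · rw [he] at hs'
    exact iff_of_true ((hM _ hs').lt_of_ne fun e => h1 (e ▸ hM)) h1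
  · rw [← hM.eq_of_sameCycle h2 hs'] at h3
    exact iff_of_false h3.not_gt (not_not.2 h1)

theorem readsOff_letter {n : ℕ} [NeZero n] (σ : Equiv.Perm (Fin n)) :
    ReadsOff (letter σ) (fun p => σ (letter σ p)) n := by
  intro k hk
  obtain ⟨hM, hs⟩ := isCycleMax_runMax σ (k := k) (by omega)
  have hs' := hs.trans (y := letter σ k) (z := σ (letter σ k)) ⟨1, by simp⟩
  have hlt := letter_lt_runMax_iff σ hk
  rcases isNextLetter_letter σ hk with ⟨h1, he⟩ | ⟨h1, h2, h3⟩
  · rw [if_pos (hlt.2 h1)]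
    exact he
  · rw [if_neg fun h => hlt.1 h h1]
    exact (hM.eq_of_sameCycle h2 hs').symm

theorem apply_letter_last {n : ℕ} [NeZero n] (σ : Equiv.Perm (Fin n)) {k : ℕ} (hk : k + 1 = n) :
    σ (letter σ k) = runMax (letter σ) k := by
  obtain ⟨hM, hs⟩ := isCycleMax_runMax σ (k := k) (by omega)
  have hs' := hs.trans (y := letter σ k) (z := σ (letter σ k)) ⟨1, by simp⟩
  refine (hM.eq_of_sameCycle ?_ hs').symm
  -- If the image of the last letter were not a cycle maximum, the letter just before it in the word
  -- would have the same image, contradicting injectivity.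
  obtain ⟨j, hj, hj'⟩ := exists_letter_eq σ (σ (letter σ k))
  rcases j with _ | j
  · rw [← hj']
    exact isCycleMax_letter_zero σ
  · rcases isNextLetter_letter σ hj with ⟨-, he⟩ | ⟨h1, -⟩
    · have := letter_injOn σ (show j < n by omega) (show k < n by omega)
        (σ.injective (he.trans hj'))
      omega
    · rwa [← hj']

theorem closedMap_letter_last {n : ℕ} [NeZero n] (σ : Equiv.Perm (Fin n)) {k : ℕ}
    (hk : k + 1 = n) :
    closedMap (letter σ) (fun p => σ (letter σ p)) k = fun p => σ (letter σ p) := by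
  funext i
  rw [closedMap]
  split_ifs with h
  · rw [h, apply_letter_last σ hk]
  · rfl

/-- Needed because an arrow occurrence in `τ` quantifies over all `σ` with `fundamental σ = τ`. The
word alone determines the image of each letter. -/
theorem fundamental_injective (n : ℕ) :
    Function.Injective (fundamental : Equiv.Perm (Fin n) → Equiv.Perm (Fin n)) := by
  rcases n with _ | n
  · exact fun _ _ _ => Subsingleton.elim _ _
  intro σ τ h
  have hw : letter σ = letter τ := funext fun p => by rw [letter, letter, h]
  ext1 x
  obtain ⟨p, hp, rfl⟩ := exists_letter_eq σ x
  rcases Nat.lt_succ_iff_lt_or_eq.1 hp with hp | rfl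
  · have h1 := readsOff_letter σ p (by omega)
    have h2 := readsOff_letter τ p (by omega)
    simp only [← hw] at h2
    exact h1.trans h2.symm
  · have h1 := apply_letter_last σ rfl
    have h2 := apply_letter_last τ rfl
    simp only [← hw] at h2
    exact h1.trans h2.symm


/-! ### The statistics as sums over positions -/

theorem sum_letter {n : ℕ} [NeZero n] (σ : Equiv.Perm (Fin n)) (F : Fin n → ℤ) :
    ∑ p ∈ Finset.range n, F (letter σ p) = ∑ x, F x := by
  rw [Finset.sum_range, ← Equiv.sum_comp (fundamental σ) F]
  exact Finset.sum_congr rfl fun p _ => by rw [letter_val]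

theorem depthSum_letter {n : ℕ} [NeZero n] (σ : Equiv.Perm (Fin n)) :
    depthSum (letter σ) (fun p => σ (letter σ p)) n = depth σ := by
  have h : ∀ x : Fin n, (∑ q ∈ Finset.range n,
      if x ≤ letter σ q ∧ letter σ q < σ x then (1 : ℤ) else 0) =
        if x < σ x then (((σ x : ℕ) - (x : ℕ) : ℕ) : ℤ) else 0 := fun x => by
    rw [sum_letter σ fun y => if x ≤ y ∧ y < σ x then (1 : ℤ) else 0, Finset.sum_boole]
    have : (Finset.univ.filter fun y => x ≤ y ∧ y < σ x) = Finset.Ico x (σ x) := by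
      ext; simp
    rw [this, Fin.card_Ico]
    split_ifs with hx
    · rfl
    · rw [Nat.sub_eq_zero_of_le (Fin.le_def.1 (not_lt.1 hx)), Nat.cast_zero]
  rw [depthSum, Finset.sum_congr rfl fun p _ => h (letter σ p),
    sum_letter σ fun x => if x < σ x then (((σ x : ℕ) - (x : ℕ) : ℕ) : ℤ) else 0, depth,
    ← Finset.sum_filter]
  push_cast
  rfl

theorem invSum_letter {n : ℕ} [NeZero n] (σ : Equiv.Perm (Fin n)) :
    invSum (letter σ) (fun p => σ (letter σ p)) n = invCount σ := by
  rw [invSum, Finset.sum_congr rfl fun p _ =>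
    sum_letter σ fun y => if letter σ p < y ∧ σ y < σ (letter σ p) then (1 : ℤ) else 0,
    sum_letter σ fun x => ∑ y, if x < y ∧ σ y < σ x then (1 : ℤ) else 0,
    ← Finset.sum_product' (f := fun x y => if x < y ∧ σ y < σ x then (1 : ℤ) else 0),
    Finset.sum_boole, invCount, Finset.univ_product_univ]

theorem sum_lt_runMax_letter {n : ℕ} [NeZero n] (σ : Equiv.Perm (Fin n)) {k : ℕ}
    (hk : k + 1 = n) :
    ∑ i ∈ Finset.range k, (if letter σ (i + 1) < runMax (letter σ) i then (1 : ℤ) else 0) =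
      nonMaxCount σ := by
  classical
  rw [nonMaxCount, ← Finset.sum_boole,
    ← sum_letter σ fun x => if ¬ IsCycleMax σ x then (1 : ℤ) else 0]
  have hr : Finset.range n = Finset.range (k + 1) := by rw [hk]
  rw [hr, Finset.sum_range_succ', if_neg (not_not.2 (isCycleMax_letter_zero σ)), add_zero]
  refine Finset.sum_congr rfl fun i hi => ?_
  have := letter_lt_runMax_iff σ (k := i) (by have := Finset.mem_range.1 hi; omega)
  simp only [this]

/-! ### Pattern counts -/

theorem ncard_eq_sum {β : Type*} (k : ℕ) (P : ℕ → ℕ → Prop) [∀ p q, Decidable (P p q)]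
    (F : ℕ → ℕ → β) (hF : ∀ p q p' q', p < q → q < k → p' < q' → q' < k → F p q = F p' q' →
      p = p' ∧ q = q') :
    ({ω | ∃ p q, p < q ∧ q < k ∧ P p q ∧ ω = F p q}.ncard : ℤ) =
      ∑ q ∈ Finset.range k, ∑ p ∈ Finset.range q, if P p q then 1 else 0 := by
  classical
  have hset : {ω | ∃ p q, p < q ∧ q < k ∧ P p q ∧ ω = F p q} =
      (fun z : (_ : ℕ) × ℕ => F z.2 z.1) '' (((Finset.range k).sigma fun q =>
        Finset.range q).filter fun z => P z.2 z.1 : Finset ((_ : ℕ) × ℕ)) := by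
    ext ω
    constructor
    · rintro ⟨p, q, hpq, hq, hP, rfl⟩
      exact ⟨⟨q, p⟩, by simp [hpq, hq, hP], rfl⟩
    · rintro ⟨⟨q, p⟩, hz, rfl⟩
      simp only [Finset.coe_filter, Finset.mem_sigma, Finset.mem_range, Set.mem_ofPred_eq] at hz
      exact ⟨p, q, hz.1.2, hz.1.1, hz.2, rfl⟩
  rw [hset, Set.InjOn.ncard_image, Set.ncard_coe_finset, ← Finset.sum_boole, Finset.sum_sigma]
  rintro ⟨q, p⟩ hz ⟨q', p'⟩ hz' h
  simp only [Finset.coe_filter, Finset.mem_sigma, Finset.mem_range, Set.mem_ofPred_eq] at hz hz'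
  obtain ⟨rfl, rfl⟩ := hF _ _ _ _ hz.1.2 hz.1.1 hz'.1.2 hz'.1.1 h
  rfl

theorem isOccurrence_pattern31_42_iff {n : ℕ} [NeZero n] (σ : Equiv.Perm (Fin n)) {k : ℕ}
    (hk : k + 1 = n) (ω : Fin 4 → Fin n) :
    pattern31_42.IsOccurrence (fundamental σ) ω ↔ ∃ p q, p < q ∧ q < k ∧
      (letter σ (p + 1) < letter σ (q + 1) ∧ letter σ (q + 1) < letter σ p ∧
        letter σ p < letter σ q) ∧
      ω = ![letter σ p, letter σ (p + 1), letter σ q, letter σ (q + 1)] := by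
  constructor
  · rintro ⟨r, hr, hω, hord, hb⟩
    have h01 : (r 1 : ℕ) = r 0 + 1 := hb 0 1 (by simp [pattern31_42]) rfl
    have h23 : (r 3 : ℕ) = r 2 + 1 := hb 2 3 (by simp [pattern31_42]) rfl
    have h02 : (r 0 : ℕ) < r 2 := hr (by decide)
    have h3 := (r 3).isLt
    have hω' : ∀ i, ω i = letter σ (r i) := fun i => by rw [hω, letter_val]
    have hlt : ∀ i j, pattern31_42.word i < pattern31_42.word j → ω i < ω j := fun i j h =>
      lt_of_not_ge fun h' => h.not_ge ((hord j i).1 h')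
    have h1 := hlt 1 3 (by decide)
    have h2 := hlt 3 0 (by decide)
    have h3 := hlt 0 2 (by decide)
    simp only [hω', h01, h23] at h1 h2 h3
    refine ⟨r 0, r 2, h02, by omega, ⟨h1, h2, h3⟩, ?_⟩
    funext i
    fin_cases i
    · exact hω' 0
    · exact (hω' 1).trans (by rw [h01]; rfl)
    · exact hω' 2
    · exact (hω' 3).trans (by rw [h23]; rfl)
  · rintro ⟨p, q, hpq, hq, ⟨h1, h2, h3⟩, rfl⟩
    -- The sums allow `p + 1 = q`, but the inequalities exclude it, so the two bonded pairs are
    -- disjoint.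
    have hne : p + 1 ≠ q := fun e => by rw [e] at h1; order
    refine ⟨![⟨p, by omega⟩, ⟨p + 1, by omega⟩, ⟨q, by omega⟩, ⟨q + 1, by omega⟩], ?_, ?_, ?_, ?_⟩
    · rw [Fin.strictMono_iff_lt_succ]
      intro i
      fin_cases i <;> simp <;> omega
    · intro i
      fin_cases i <;> exact letter_val σ ⟨_, _⟩
    · intro i j
      fin_cases i <;> fin_cases j <;> simp [pattern31_42] <;> order
    · intro i j hi hj
      fin_cases i <;> fin_cases j <;> simp [pattern31_42] at hi hj ⊢

theorem isOccurrence_pattern2_13_arrow24_iff {n : ℕ} [NeZero n] (σ : Equiv.Perm (Fin n)) {k : ℕ}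
    (hk : k + 1 = n) (ω : Fin 3 → Fin n) :
    pattern2_13_arrow24.IsOccurrence (fundamental σ) ω ↔ ∃ p q, p < q ∧ q < k ∧
      (letter σ q < letter σ p ∧ letter σ p < letter σ (q + 1) ∧
        letter σ (q + 1) < σ (letter σ p)) ∧
      ω = ![letter σ p, letter σ q, letter σ (q + 1)] := by
  constructor
  · rintro ⟨σ', hσ', x, hx, hωx, ⟨r, hr, hω, hord, hb⟩, harr⟩
    obtain rfl := fundamental_injective n hσ'
    have h12 : (r 2 : ℕ) = r 1 + 1 := hb 1 2 (by simp [pattern2_13_arrow24]) rfl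
    have h01 : (r 0 : ℕ) < r 1 := hr (by decide)
    have hlt := (r 2).isLt
    have hω' : ∀ i, ω i = letter σ' (r i) := fun i => by rw [hω, letter_val]
    have e0 : letter σ' (r 0) = x 1 := (hω' 0).symm.trans (hωx 0)
    have e1 : letter σ' (r 1) = x 0 := (hω' 1).symm.trans (hωx 1)
    have e2 : letter σ' (r 1 + 1) = x 2 := by rw [← h12]; exact (hω' 2).symm.trans (hωx 2)
    have e3 : σ' (x 1) = x 3 := harr (1, 3) rfl
    refine ⟨r 0, r 1, h01, by omega, ?_, ?_⟩
    · rw [e0, e1, e2, e3]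
      exact ⟨hx (by decide), hx (by decide), hx (by decide)⟩
    · funext i
      fin_cases i
      · exact hω' 0
      · exact hω' 1
      · exact (hω' 2).trans (by rw [h12]; rfl)
  · rintro ⟨p, q, hpq, hq, ⟨h1, h2, h3⟩, rfl⟩
    refine ⟨σ, rfl, ![letter σ q, letter σ p, letter σ (q + 1), σ (letter σ p)], ?_, ?_,
      ⟨![⟨p, by omega⟩, ⟨q, by omega⟩, ⟨q + 1, by omega⟩], ?_, ?_, ?_, ?_⟩, ?_⟩
    · rw [Fin.strictMono_iff_lt_succ]
      intro i
      fin_cases i <;> simpa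
    · intro i
      fin_cases i <;> rfl
    · rw [Fin.strictMono_iff_lt_succ]
      intro i
      fin_cases i <;> simp <;> omega
    · intro i
      fin_cases i <;> exact letter_val σ ⟨_, _⟩
    · intro i j
      fin_cases i <;> fin_cases j <;> simp [pattern2_13_arrow24] <;> order
    · intro i j hi hj
      fin_cases i <;> fin_cases j <;> simp [pattern2_13_arrow24] at hi hj ⊢
    · rintro e rfl
      rfl

theorem count_pattern31_42 {n : ℕ} [NeZero n] (σ : Equiv.Perm (Fin n)) {k : ℕ}
    (hk : k + 1 = n) :
    (pattern31_42.count (fundamental σ) : ℤ) = crossSum (letter σ) k := by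
  simp only [VincularPattern.count, isOccurrence_pattern31_42_iff σ hk]
  refine ncard_eq_sum k _ _ fun p q p' q' hpq hq hpq' hq' h => ⟨?_, ?_⟩
  · exact letter_injOn σ (show p < n by omega) (show p' < n by omega) (congrFun h 0)
  · exact letter_injOn σ (show q < n by omega) (show q' < n by omega) (congrFun h 2)

theorem count_pattern2_13_arrow24 {n : ℕ} [NeZero n] (σ : Equiv.Perm (Fin n)) {k : ℕ}
    (hk : k + 1 = n) :
    (pattern2_13_arrow24.count (fundamental σ) : ℤ) =
      arrowSum (letter σ) (fun p => σ (letter σ p)) k := by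
  simp only [ArrowPattern.count, isOccurrence_pattern2_13_arrow24_iff σ hk]
  refine ncard_eq_sum k _ _ fun p q p' q' hpq hq hpq' hq' h => ⟨?_, ?_⟩
  · exact letter_injOn σ (show p < n by omega) (show p' < n by omega) (congrFun h 0)
  · exact letter_injOn σ (show q < n by omega) (show q' < n by omega) (congrFun h 1)

/-! ### The depth formula and avoidance. -/

theorem two_mul_depth_eq {n : ℕ} (σ : Equiv.Perm (Fin n)) :
    2 * (depth σ : ℤ) = length σ + reflectionLength σ +
      2 * (pattern31_42.count (fundamental σ) + pattern2_13_arrow24.count (fundamental σ)) := by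
  rw [length_eq_invCount, reflectionLength_eq_nonMaxCount]
  -- `letter` needs a nonempty alphabet, so `n = 0` is checked directly.
  rcases n with _ | k
  · have h1 : pattern31_42.count (fundamental σ) = 0 := by
      rw [VincularPattern.count, Set.eq_empty_of_isEmpty {ω | _}, Set.ncard_empty]
    have h2 : pattern2_13_arrow24.count (fundamental σ) = 0 := by
      rw [ArrowPattern.count, Set.eq_empty_of_isEmpty {ω | _}, Set.ncard_empty]
    simp [depth, invCount, nonMaxCount, h1, h2]
  · have key := (readsOff_letter σ).depthSum_eq (letter_injOn σ) (Nat.lt_succ_self k)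
    rw [closedMap_letter_last σ rfl, depthSum_letter, invSum_letter,
      sum_lt_runMax_letter σ rfl, ← count_pattern31_42 σ rfl,
      ← count_pattern2_13_arrow24 σ rfl] at key
    exact key

theorem VincularPattern.avoids_iff_count_eq_zero {k m n : ℕ} (ν : VincularPattern k m)
    (τ : Equiv.Perm (Fin n)) : ν.Avoids τ ↔ ν.count τ = 0 := by
  rw [VincularPattern.count, Set.ncard_eq_zero (Set.toFinite _), Set.eq_empty_iff_forall_notMem,
    VincularPattern.Avoids, not_exists]
  rfl

theorem ArrowPattern.avoids_iff_count_eq_zero {k m n : ℕ} (α : ArrowPattern k m)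
    (τ : Equiv.Perm (Fin n)) : α.Avoids τ ↔ α.count τ = 0 := by
  rw [ArrowPattern.count, Set.ncard_eq_zero (Set.toFinite _), Set.eq_empty_iff_forall_notMem,
    ArrowPattern.Avoids, not_exists]
  rfl

end ShallowPerm

theorem mainTheorem2 {n : ℕ} (σ : Equiv.Perm (Fin n)) :
    (ShallowPerm.depth σ : ℚ) =
        ((ShallowPerm.length σ : ℚ) + (ShallowPerm.reflectionLength σ : ℚ)) / 2 +
          ((ShallowPerm.pattern31_42.count (ShallowPerm.fundamental σ) : ℚ) +
            (ShallowPerm.pattern2_13_arrow24.count (ShallowPerm.fundamental σ) : ℚ)) ∧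
      (ShallowPerm.IsShallow σ ↔
        ShallowPerm.pattern31_42.Avoids (ShallowPerm.fundamental σ) ∧
          ShallowPerm.pattern2_13_arrow24.Avoids (ShallowPerm.fundamental σ)) := by
  have h := ShallowPerm.two_mul_depth_eq σ
  have hQ : 2 * (ShallowPerm.depth σ : ℚ) =
      ShallowPerm.length σ + ShallowPerm.reflectionLength σ +
        2 * (ShallowPerm.pattern31_42.count (ShallowPerm.fundamental σ) +
          ShallowPerm.pattern2_13_arrow24.count (ShallowPerm.fundamental σ)) := by
    exact_mod_cast h
  refine ⟨by linarith, ?_⟩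
  rw [ShallowPerm.VincularPattern.avoids_iff_count_eq_zero,
    ShallowPerm.ArrowPattern.avoids_iff_count_eq_zero, ShallowPerm.IsShallow]
  constructor
  · intro hs
    have h0 : (ShallowPerm.pattern31_42.count (ShallowPerm.fundamental σ) : ℚ) +
        ShallowPerm.pattern2_13_arrow24.count (ShallowPerm.fundamental σ) = 0 := by linarith
    exact Nat.add_eq_zero_iff.1 (by exact_mod_cast h0)
  · rintro ⟨h1, h2⟩
    rw [h1, h2] at hQ
    push_cast at hQ
    linarith
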